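/- Write $\bar x = x^{-1}$ and $\sigma(x) = x - \bar x$. Consider the square ice on the $n\times n$ grid with domain wall boundary conditions: a state is an orientation of all edges (including the $4n$ external ones) such that two edges enter and two edges leave every vertex of the grid, the external horizontal edges point inwards and the external vertical edges point outwards. The vertex in row $i$ and column $j$ (rows counted from the top, columns from the left) has spectral parameter $x = x_i/y_j$ and the following weight, where $a$ is a parameter common to all vertices: $\sigma(a^2)$ if its two horizontal edges both enter or both leave it; $\sigma(a x)$ if its horizontal edges both point right and its vertical edges both point up, or its horizontal edges both point left and its vertical edges both point down; $\sigma(a\bar x)$ if its horizontal edges both point left and its vertical edges both point up, or its horizontal edges both point right and its vertical edges both point down. The weight of a state is the product of the weights of its vertices, and the partition function $Z(n;\boldsymbol x,\boldsymbol y)$ is the sum of the weights of all states. For $\boldsymbol u = (u_1,\ldots,u_{2n})$ let $Z(n;\boldsymbol u)$ be $Z(n;\boldsymbol x,\boldsymbol y)$ with $x_i = u_{2i-1}$ and $y_i = u_{2i}$ for $i = 1,\ldots,n$. Let $P(n;\boldsymbol u)$ be the $2n\times 2n$ matrix whose rows are indexed, in increasing order, by the $2n$ integers $k$ with $1\le k\le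 3n-1$ and $3\nmid k$, whose columns are indexed by $\mu = 1,\ldots,2n$, and whose entry in row $k$ and column $\mu$ is $u_\mu^{3n-2k}$. Theorem. Let $a = e^{\mathrm i\pi/3}$ and let $u_1,\ldots,u_{2n}$ be nonzero complex numbers with $u_\mu^2\ne u_\nu^2$ for all $\mu<\nu$. Then $$Z(n;\boldsymbol u) = (-1)^{\frac{n(n-1)}{2}}\,\frac{\sigma(a)^n}{\prod_{1\le\mu<\nu\le 2n}\sigma(u_\mu\,\bar u_\nu)}\,\det P(n;\boldsymbol u).$$ -/

import Mathlib

open scoped BigOperators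

namespace SquareIce

/-- `σ(x) = x - x⁻¹`. -/
noncomputable def sigma (x : ℂ) : ℂ := x - x⁻¹

/-- An orientation of the edges of the `n × n` square grid with its `4 n` external edges.
Rows are numbered from the top and columns from the left, starting at `0`.
* `hor i j` (for `j = 0, …, n`) is the horizontal edge of row `i` just to the left of column `j`
  (for `j = n`: the external edge on the right); `true` means that it points to the right.
* `ver i j` (for `i = 0, …, n`) is the vertical edge of column `j` just above row `i`
  (for `i = n`: the external edge at the bottom); `true` means that it points upwards. -/
abbrev Orientation (n : ℕ) : Type :=
  (Fin n → Fin (n + 1) → Bool) × (Fin (n + 1) → Fin n → Bool)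

variable {n : ℕ}

/-- The edge to the left of the vertex `(i, j)` points to the right. -/
def Orientation.left (s : Orientation n) (i j : Fin n) : Bool := s.1 i j.castSucc

/-- The edge to the right of the vertex `(i, j)` points to the right. -/
def Orientation.right (s : Orientation n) (i j : Fin n) : Bool := s.1 i j.succ

/-- The edge above the vertex `(i, j)` points upwards. -/
def Orientation.top (s : Orientation n) (i j : Fin n) : Bool := s.2 i.castSucc j

/-- The edge below the vertex `(i, j)` points upwards. -/
def Orientation.bottom (s : Orientation n) (i j : Fin n) : Bool := s.2 i.succ j

/-- The number of edges that enter the tetravalent vertex `(i, j)`. -/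
def Orientation.inDegree (s : Orientation n) (i j : Fin n) : ℕ :=
  (if s.left i j then 1 else 0) + (if s.right i j then 0 else 1)
    + (if s.top i j then 0 else 1) + (if s.bottom i j then 1 else 0)

/-- States of square ice with domain wall boundary: two edges enter (so two edges leave) every
tetravalent vertex, the external horizontal edges point inwards, and the external vertical edges
point outwards. -/
def Orientation.IsState (s : Orientation n) : Prop :=
  (∀ i j, s.inDegree i j = 2) ∧
  (∀ i, s.1 i 0 = true) ∧ (∀ i, s.1 i (Fin.last n) = false) ∧
  (∀ j, s.2 0 j = true) ∧ (∀ j, s.2 (Fin.last n) j = false)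

instance : DecidablePred (Orientation.IsState (n := n)) := fun s => by
  unfold Orientation.IsState; infer_instance

/-- The Boltzmann weight of a vertex with spectral parameter `x` and orientations `l r t b` of
its left, right, top and bottom edges (`true`: right, or up). The six lines are the six vertices
obeying the ice rule; they correspond to the entries `1, -1, 0, 0, 0, 0` of an
alternating-sign matrix. Other orientations never occur in a state. -/
noncomputable def vertexWeight (a x : ℂ) (l r t b : Bool) : ℂ :=
  match l, r, t, b with
  | true, false, true, false => sigma (a ^ 2)
  | false, true, false, true => sigma (a ^ 2)
  | true, true, true, true => sigma (a * x)
  | false, false, false, false => sigma (a * x)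
  | false, false, true, true => sigma (a * x⁻¹)
  | true, true, false, false => sigma (a * x⁻¹)
  | _, _, _, _ => 0

/-- The weight of a state: the vertex in row `i` and column `j` has spectral parameter
`x i / y j`. -/
noncomputable def Orientation.weight (s : Orientation n) (a : ℂ) (x y : Fin n → ℂ) : ℂ :=
  ∏ i, ∏ j, vertexWeight a (x i / y j) (s.left i j) (s.right i j) (s.top i j) (s.bottom i j)

/-- The partition function `Z(n; x, y)` of square ice with domain wall boundary. -/
noncomputable def partitionFunction (n : ℕ) (a : ℂ) (x y : Fin n → ℂ) : ℂ :=
  ∑ s : Orientation n with s.IsState, s.weight a x y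

/-- `Z(n; u)` for `u = (u₁, …, u₂ₙ) = (x₁, y₁, x₂, y₂, …, xₙ, yₙ)`. -/
noncomputable def partitionFunctionCombined (n : ℕ) (a : ℂ) (u : Fin (2 * n) → ℂ) : ℂ :=
  partitionFunction n a (fun i => u ⟨2 * i.val, by omega⟩) (fun i => u ⟨2 * i.val + 1, by omega⟩)

/-- The (zero-based) `r`-th positive integer not divisible by `3`: `1, 2, 4, 5, 7, 8, …`. -/
def nonMultipleOfThree (r : ℕ) : ℕ := r + r / 2 + 1

/-- The `2n × 2n` matrix `P(n; u)`: its rows correspond to the integers `1 ≤ k ≤ 3n - 1` not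
divisible by `3`, in increasing order, and the entry in row `k` and column `μ` is
`u_μ ^ (3n - 2k)`. -/
noncomputable def matrixP (n : ℕ) (u : Fin (2 * n) → ℂ) : Matrix (Fin (2 * n)) (Fin (2 * n)) ℂ :=
  Matrix.of fun r μ => u μ ^ (3 * (n : ℤ) - 2 * (nonMultipleOfThree r.val : ℤ))

end SquareIce

/-!
Multiply the formula by the Vandermonde-type denominator and let `D u` be the difference of the two
sides. As a function of the first parameter alone, `D` is a Laurent polynomial of fixed parity and
degree `3n + 1` (at size `n + 1`), so it vanishes identically once it has `3n + 2` zeros with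
distinct squares.

It vanishes trivially when the first parameter equals one of the other `2n + 1`. When `y₁ = a x₁`
the first row and the first column of the ice freeze, and because
`σ(a⁻¹ z) σ(z) σ(a z) = σ(z³)` at a primitive sixth root of unity, all three factors of the formula
satisfy matching recursions and `D` reduces to its value at size `n`, which is zero by induction.
The Yang–Baxter equation makes the partition function symmetric in the `y_j`, so the same holds
when `y_j = a x₁` for any `j`, which gives `n + 1` further zeros. The parameters at which this count
fails are removed by continuity.
-/

namespace SquareIce

theorem ofFn_prod_apply {α R : Type*} [Fintype α] [DecidableEq α] [CommSemiring R]
    {m : ℕ} (M : Fin m → Matrix α α R) (p q : α) :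
    (List.ofFn M).prod p q =
      ∑ w : Fin (m + 1) → α with w 0 = p ∧ w (Fin.last m) = q,
        ∏ i, M i (w i.castSucc) (w i.succ) := by
  induction m generalizing p with
  | zero =>
    rw [Finset.sum_filter, ← (Equiv.funUnique (Fin 1) α).symm.sum_comp]
    simp only [List.ofFn_zero, List.prod_nil, Matrix.one_apply, Equiv.funUnique_symm_apply,
      uniqueElim_const, Finset.univ_eq_empty, Finset.prod_empty, ite_and, Finset.sum_ite_eq',
      Finset.mem_univ, if_true]
  | succ m ih =>
    have tail_sum (b : α) : (∑ w : Fin (m + 1) → α,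
        if b = p ∧ w (Fin.last m) = q then
          M 0 b (w 0) * ∏ i : Fin m, M i.succ (w i.castSucc) (w i.succ)
        else 0) = if b = p then ∑ c, M 0 p c * (List.ofFn fun i => M i.succ).prod c q else 0 := by
      split_ifs with hb
      · simp only [ih, hb, true_and, Finset.sum_filter, Finset.mul_sum, mul_ite, mul_zero, ite_and]
        rw [Finset.sum_comm]
        simp only [Finset.sum_ite_eq, Finset.mem_univ, if_true]
      · simp only [hb, false_and, if_false, Finset.sum_const_zero]
    rw [List.ofFn_succ, List.prod_cons, Matrix.mul_apply, Finset.sum_filter,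
      ← (Fin.consEquiv fun _ => α).sum_comp, Fintype.sum_prod_type]
    simp only [Fin.consEquiv_apply, Fin.cons_zero, ← Fin.succ_last, Fin.cons_succ,
      Fin.prod_univ_succ, Fin.castSucc_zero, ← Fin.succ_castSucc, tail_sum, Finset.sum_ite_eq',
      Finset.mem_univ, if_true]

section Matrices

variable {R : Type*} [CommRing R] {m k : ℕ}

theorem det_eq_det_mul_det_of_lowerLeft_eq_zero (M : Matrix (Fin (m + k)) (Fin (m + k)) R)
    (h : ∀ (r : Fin m) (s : Fin k), M (r.addNat k) (s.castLE (Nat.le_add_left k m)) = 0) :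
    M.det = (M.submatrix (Fin.castLE (Nat.le_add_left k m))
        (Fin.castLE (Nat.le_add_left k m))).det *
      (M.submatrix (Fin.addNat · k) (Fin.addNat · k)).det := by
  let e : Fin k ⊕ Fin m ≃ Fin (m + k) := finSumFinEquiv.trans (finCongr (Nat.add_comm k m))
  have e_inl (s : Fin k) : e (Sum.inl s) = s.castLE (Nat.le_add_left k m) := rfl
  have e_inr (r : Fin m) : e (Sum.inr r) = r.addNat k := Fin.ext (Nat.add_comm k r)
  rw [← Matrix.det_submatrix_equiv_self e, ← Matrix.det_fromBlocks_zero₂₁ _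
    (M.submatrix (Fin.castLE (Nat.le_add_left k m)) (Fin.addNat · k))]
  congr 1
  ext (r | r) (s | s) <;>
    simp only [Matrix.submatrix_apply, e_inl, e_inr, Matrix.fromBlocks_apply₁₁,
      Matrix.fromBlocks_apply₁₂, Matrix.fromBlocks_apply₂₁, Matrix.fromBlocks_apply₂₂, h,
      Matrix.zero_apply]

theorem det_eq_det_mul_det_of_lagged_row_add_eq_zero (hk : k ≠ 0)
    (M : Matrix (Fin (m + k)) (Fin (m + k)) R) (c : R)
    (h : ∀ (r : Fin m) (s : Fin k), M (r.addNat k) (s.castLE (Nat.le_add_left k m)) +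
      c * M (r.castAdd k) (s.castLE (Nat.le_add_left k m)) = 0) :
    M.det = (M.submatrix (Fin.castLE (Nat.le_add_left k m))
        (Fin.castLE (Nat.le_add_left k m))).det *
      (Matrix.of fun r s : Fin m =>
        M (r.addNat k) (s.addNat k) + c * M (r.castAdd k) (s.addNat k)).det := by
  let S : Matrix (Fin (m + k)) (Fin (m + k)) R :=
    Matrix.of fun r s => if s.val + k = r.val then c else 0
  have det_one_add_S : (1 + S).det = 1 := by
    rw [Matrix.det_of_isLowerTriangular]
    · refine Finset.prod_eq_one fun r _ => ?_
      simp [S, hk]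
    · intro r s hrs
      have hrs : r.val < s.val := hrs
      have hne : r ≠ s := fun e => hrs.ne (congrArg Fin.val e)
      have hlag : s.val + k ≠ r.val := by omega
      simp [S, hne, hlag]
  have mul_addNat (r : Fin m) (s) :
      ((1 + S) * M) (r.addNat k) s = M (r.addNat k) s + c * M (r.castAdd k) s := by
    have hlag (t : Fin (m + k)) : t.val + k = (r.addNat k).val ↔ t = r.castAdd k := by
      simp [Fin.ext_iff]
    rw [add_mul, one_mul, Matrix.add_apply]
    simp only [Matrix.mul_apply, S, Matrix.of_apply, hlag, ite_mul, zero_mul,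
      Finset.sum_ite_eq', Finset.mem_univ, if_true]
  have mul_castLE (r : Fin k) (s) : ((1 + S) * M) (r.castLE (Nat.le_add_left k m)) s =
      M (r.castLE (Nat.le_add_left k m)) s := by
    have hlag (t : Fin (m + k)) : t.val + k ≠ r.val := by omega
    rw [add_mul, one_mul, Matrix.add_apply]
    simp only [Matrix.mul_apply, S, Matrix.of_apply, Fin.val_castLE, hlag, if_false, zero_mul,
      Finset.sum_const_zero, add_zero]
  rw [← one_mul M.det, ← det_one_add_S, ← Matrix.det_mul,
    det_eq_det_mul_det_of_lowerLeft_eq_zero ((1 + S) * M)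
      fun r s => (mul_addNat r _).trans (h r s)]
  congr 2
  · ext r s
    exact mul_castLE r _
  · ext r s
    exact mul_addNat r _

end Matrices

section Continuity

variable {K : Type*} [NontriviallyNormedField K] {m : ℕ}

open Filter Topology Polynomial

theorem finite_setOf_mul_pow_eq_mul_pow {b c : K} (hb : b ≠ 0) {i j : ℕ} (hij : i ≠ j) :
    {t : K | b * t ^ i = c * t ^ j}.Finite := by
  have hp : C b * X ^ i - C c * X ^ j ≠ 0 := fun h => hb <| by
    simpa [coeff_X_pow, hij] using congrArg (coeff · i) h
  refine (finite_setOfPred_isRoot hp).subset fun t ht => ?_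
  simpa [IsRoot, sub_eq_zero] using ht

/-- The perturbation `u μ * t ^ μ` with `t → 1` separates the powers. -/
theorem frequently_nhds_injective_pow {u : Fin m → K} (hu : ∀ μ, u μ ≠ 0) {k : ℕ} (hk : k ≠ 0) :
    ∃ᶠ v in 𝓝 u, (∀ μ, v μ ≠ 0) ∧ Function.Injective fun μ => v μ ^ k := by
  let w : K → Fin m → K := fun t μ => u μ * t ^ μ.val
  have w_tendsto : Tendsto w (𝓝[≠] 1) (𝓝 u) := by
    have : Continuous w := by fun_prop
    simpa [w] using (this.tendsto 1).mono_left nhdsWithin_le_nhds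
  have coincidence_finite : {t : K | ∃ μ ν, μ ≠ ν ∧ w t μ ^ k = w t ν ^ k}.Finite := by
    simp only [Set.ofPred_exists, Set.ofPred_and]
    refine Set.finite_iUnion fun μ => Set.finite_iUnion fun ν => ?_
    by_cases hμν : μ = ν
    · simp [hμν]
    · refine (finite_setOf_mul_pow_eq_mul_pow (c := u ν ^ k) (pow_ne_zero k (hu μ))
        (i := μ.val * k) (j := ν.val * k) ?_).subset ?_
      · exact fun h => hμν (Fin.ext (Nat.eq_of_mul_eq_mul_right (Nat.pos_of_ne_zero hk) h))
      · rintro t ⟨-, ht⟩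
        simpa only [w, mul_pow, ← pow_mul] using ht
  have w_good : ∀ᶠ t in 𝓝[≠] (1 : K),
      (∀ μ, w t μ ≠ 0) ∧ Function.Injective fun μ => w t μ ^ k := by
    filter_upwards
      [coincidence_finite.eventually_cofinite_notMem.filter_mono (nhdsNE_le_cofinite 1),
      (eventually_ne_nhds one_ne_zero).filter_mono nhdsWithin_le_nhds] with t ht ht0
    refine ⟨fun μ => mul_ne_zero (hu μ) (pow_ne_zero _ ht0), fun μ ν h => ?_⟩
    by_contra hμν
    exact ht ⟨μ, ν, hμν, h⟩
  exact w_tendsto.frequently w_good.frequently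

end Continuity

section TransferMatrix

variable {m n : ℕ}

/-- The weight of a column with vertical spectral parameter `y`, as a matrix indexed by the
orientations of the horizontal edges on its left and on its right. -/
noncomputable def columnMatrix (a : ℂ) (x : Fin m → ℂ) (y : ℂ) :
    Matrix (Fin m → Bool) (Fin m → Bool) ℂ :=
  Matrix.of fun l r => ∑ v : Fin (m + 1) → Bool with v 0 = true ∧ v (Fin.last m) = false,
    ∏ i, vertexWeight a (x i / y) (l i) (r i) (v i.castSucc) (v i.succ)

theorem inDegree_eq_two_of_vertexWeight_ne_zero {a x : ℂ} (s : Orientation n) (i j : Fin n)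
    (h : vertexWeight a x (s.left i j) (s.right i j) (s.top i j) (s.bottom i j) ≠ 0) :
    s.inDegree i j = 2 := by
  unfold Orientation.inDegree
  revert h
  cases s.left i j <;> cases s.right i j <;> cases s.top i j <;> cases s.bottom i j <;>
    simp [vertexWeight]

theorem inDegree_eq_two_of_weight_ne_zero {s : Orientation n} {a : ℂ} {x y : Fin n → ℂ}
    (h : s.weight a x y ≠ 0) (i j : Fin n) : s.inDegree i j = 2 :=
  inDegree_eq_two_of_vertexWeight_ne_zero s i j <| Finset.prod_ne_zero_iff.1
    (Finset.prod_ne_zero_iff.1 h i (Finset.mem_univ i)) j (Finset.mem_univ j)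

theorem partitionFunction_eq_sum_sum (a : ℂ) (x y : Fin n → ℂ) :
    partitionFunction n a x y =
      ∑ h : Fin n → Fin (n + 1) → Bool with
          (∀ i, h i 0 = true) ∧ ∀ i, h i (Fin.last n) = false,
        ∑ v : Fin (n + 1) → Fin n → Bool with
            (∀ j, v 0 j = true) ∧ ∀ j, v (Fin.last n) j = false,
          Orientation.weight (h, v) a x y := by
  rw [← Finset.sum_product']
  refine Finset.sum_subset (fun s hs => ?_) fun s hs hns => ?_
  · obtain ⟨-, hl, hr, hv⟩ := (Finset.mem_filter_univ s).1 hs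
    simp only [Finset.mem_product, Finset.mem_filter_univ]
    exact ⟨⟨hl, hr⟩, hv⟩
  · simp only [Finset.mem_product, Finset.mem_filter_univ] at hs
    by_contra hw
    exact hns ((Finset.mem_filter_univ s).2
      ⟨inDegree_eq_two_of_weight_ne_zero hw, hs.1.1, hs.1.2, hs.2⟩)

theorem prod_columnMatrix_apply (a : ℂ) (x y : Fin n → ℂ) (w : Fin (n + 1) → Fin n → Bool) :
    ∏ j, columnMatrix a x (y j) (w j.castSucc) (w j.succ) =
      ∑ v : Fin (n + 1) → Fin n → Bool with
          (∀ j, v 0 j = true) ∧ ∀ j, v (Fin.last n) j = false,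
        Orientation.weight (fun i j => w j i, v) a x y := by
  simp only [columnMatrix, Matrix.of_apply]
  rw [Finset.prod_univ_sum]
  refine Finset.sum_equiv (Equiv.piComm fun _ _ => Bool) (fun v => ?_) fun v _ => ?_
  · simp only [Fintype.mem_piFinset, Finset.mem_filter_univ, forall_and, Equiv.piComm_apply,
      Function.swap]
  · rw [Orientation.weight, Finset.prod_comm]
    rfl

theorem partitionFunction_eq_ofFn_prod (a : ℂ) (x y : Fin n → ℂ) :
    partitionFunction n a x y =
      (List.ofFn fun j => columnMatrix a x (y j)).prod (fun _ => true) (fun _ => false) := by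
  rw [partitionFunction_eq_sum_sum, ofFn_prod_apply]
  refine Finset.sum_equiv (Equiv.piComm fun _ _ => Bool) (fun h => ?_) fun h _ => ?_
  · simp only [Finset.mem_filter_univ, Equiv.piComm_apply, funext_iff, Function.swap]
  · rw [prod_columnMatrix_apply]
    rfl

end TransferMatrix

section YangBaxter

variable {m n : ℕ} {a y y' : ℂ}

/-- The weight of two horizontally adjacent vertices with outer horizontal edges `l` and `r`, as a
matrix indexed by the orientations of the two edges above and of the two edges below. -/
noncomputable def pairMatrix (a x y y' : ℂ) (l r : Bool) : Matrix (Bool × Bool) (Bool × Bool) ℂ :=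
  Matrix.of fun t b =>
    ∑ m, vertexWeight a (x / y) l m t.1 b.1 * vertexWeight a (x / y') m r t.2 b.2

/-- The weight of the crossing of two vertical lines whose spectral parameters have ratio `z`: the
matrix that intertwines the two orders of a pair of adjacent columns. -/
noncomputable def crossMatrix (a z : ℂ) : Matrix (Bool × Bool) (Bool × Bool) ℂ :=
  Matrix.of fun t b =>
    if t = b then if t.1 = t.2 then sigma (a ^ 2 * z) else sigma (a ^ 2)
    else if t.1 = b.2 ∧ t.2 = b.1 then sigma z⁻¹ else 0

theorem crossMatrix_mul_apply_true (z : ℂ) (M : Matrix (Bool × Bool) (Bool × Bool) ℂ)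
    (q : Bool × Bool) :
    (crossMatrix a z * M) (true, true) q = sigma (a ^ 2 * z) * M (true, true) q := by
  simp [Matrix.mul_apply, crossMatrix, Fintype.sum_prod_type]

theorem mul_crossMatrix_apply_false (z : ℂ) (M : Matrix (Bool × Bool) (Bool × Bool) ℂ)
    (p : Bool × Bool) :
    (M * crossMatrix a z) p (false, false) = M p (false, false) * sigma (a ^ 2 * z) := by
  simp [Matrix.mul_apply, crossMatrix, Fintype.sum_prod_type]

/-- The Yang–Baxter equation. -/
theorem crossMatrix_mul_pairMatrix {x : ℂ} (ha : a ≠ 0) (hx : x ≠ 0) (hy : y ≠ 0) (hy' : y' ≠ 0)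
    (l r : Bool) :
    crossMatrix a (y / y') * pairMatrix a x y y' l r =
      pairMatrix a x y' y l r * crossMatrix a (y / y') := by
  ext ⟨t, t'⟩ ⟨b, b'⟩
  simp only [Matrix.mul_apply, crossMatrix, pairMatrix, Matrix.of_apply, Fintype.sum_prod_type,
    Fintype.sum_bool]
  cases l <;> cases r <;> cases t <;> cases t' <;> cases b <;> cases b' <;>
    simp [vertexWeight, sigma] <;> field_simp <;> ring

theorem crossMatrix_mul_ofFn_prod {x : Fin m → ℂ} (ha : a ≠ 0) (hx : ∀ i, x i ≠ 0) (hy : y ≠ 0)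
    (hy' : y' ≠ 0) (l r : Fin m → Bool) :
    crossMatrix a (y / y') * (List.ofFn fun i => pairMatrix a (x i) y y' (l i) (r i)).prod =
      (List.ofFn fun i => pairMatrix a (x i) y' y (l i) (r i)).prod * crossMatrix a (y / y') := by
  induction m with
  | zero => simp
  | succ m ih =>
    rw [List.ofFn_succ, List.ofFn_succ, List.prod_cons, List.prod_cons, ← mul_assoc,
      crossMatrix_mul_pairMatrix ha (hx 0) hy hy', mul_assoc,
      ih (fun i => hx i.succ) (fun i => l i.succ) fun i => r i.succ, mul_assoc]

theorem columnMatrix_mul_apply (a y y' : ℂ) (x : Fin m → ℂ) (l r : Fin m → Bool) :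
    (columnMatrix a x y * columnMatrix a x y') l r =
      (List.ofFn fun i => pairMatrix a (x i) y y' (l i) (r i)).prod
        (true, true) (false, false) := by
  rw [ofFn_prod_apply, Matrix.mul_apply]
  simp only [columnMatrix, Matrix.of_apply, Finset.sum_mul_sum, ← Finset.sum_product']
  rw [Finset.sum_product_right]
  refine Finset.sum_equiv (Equiv.arrowProdEquivProdArrow _ (fun _ => Bool) fun _ => Bool).symm
    (fun v => ?_) fun v _ => ?_
  · simp only [Finset.mem_product, Finset.mem_filter_univ,
      Equiv.arrowProdEquivProdArrow_symm_apply, Prod.mk.injEq]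
    exact and_and_and_comm
  · simp only [pairMatrix, Matrix.of_apply, Fintype.prod_sum,
      Equiv.arrowProdEquivProdArrow_symm_apply, Finset.prod_mul_distrib]

theorem columnMatrix_mul_comm {x : Fin m → ℂ} (ha : a ≠ 0) (hx : ∀ i, x i ≠ 0) (hy : y ≠ 0)
    (hy' : y' ≠ 0) (h : sigma (a ^ 2 * (y / y')) ≠ 0) :
    columnMatrix a x y * columnMatrix a x y' = columnMatrix a x y' * columnMatrix a x y := by
  ext l r
  refine mul_left_cancel₀ h ?_
  rw [columnMatrix_mul_apply, columnMatrix_mul_apply, ← crossMatrix_mul_apply_true,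
    crossMatrix_mul_ofFn_prod ha hx hy hy', mul_crossMatrix_apply_false, mul_comm]

theorem partitionFunction_comp_perm {x y : Fin n → ℂ} (ha : a ≠ 0) (hx : ∀ i, x i ≠ 0)
    (hy : ∀ j, y j ≠ 0) (h : ∀ i j, i ≠ j → sigma (a ^ 2 * (y i / y j)) ≠ 0)
    (τ : Equiv.Perm (Fin n)) :
    partitionFunction n a x (y ∘ τ) = partitionFunction n a x y := by
  rw [partitionFunction_eq_ofFn_prod, partitionFunction_eq_ofFn_prod]
  refine congrFun (congrFun
    ((τ.ofFn_comp_perm fun j => columnMatrix a x (y j)).prod_eq' ?_) _) _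
  exact List.pairwise_ofFn.2 fun i j hij =>
    columnMatrix_mul_comm ha hx (hy _) (hy _) (h _ _ fun e => hij.ne (τ.injective e))

end YangBaxter

section Corner

variable {n : ℕ}

theorem sigma_one : sigma 1 = 0 := by simp [sigma]

namespace Orientation

/-- The state of size `n + 1` obtained from `s` by adding a row on top and a column on the left
in which every line goes straight except at the corner vertex, where both lines turn. -/
def addFrozen (s : Orientation n) : Orientation (n + 1) :=
  (Fin.cons (Fin.cons true fun _ => false) fun i => Fin.cons true (s.1 i),
    Fin.cons (fun _ => true) fun i => Fin.cons false (s.2 i))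

/-- The orientation of the edges that remain when the first row and column are deleted. -/
def removeCorner (s : Orientation (n + 1)) : Orientation n :=
  (fun i j => s.1 i.succ j.succ, fun i j => s.2 i.succ j.succ)

theorem removeCorner_addFrozen (s : Orientation n) : s.addFrozen.removeCorner = s := rfl

theorem addFrozen_injective : Function.Injective (addFrozen (n := n)) :=
  Function.LeftInverse.injective removeCorner_addFrozen

theorem right_eq_left_and_bottom_eq_top {s : Orientation n} {i j : Fin n}
    (h : s.inDegree i j = 2) (hlt : s.left i j ≠ s.top i j) :
    s.right i j = s.left i j ∧ s.bottom i j = s.top i j := by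
  unfold inDegree at h
  revert h hlt
  cases s.left i j <;> cases s.top i j <;> cases s.right i j <;> cases s.bottom i j <;> simp

theorem bottom_eq_right {s : Orientation n} {i j : Fin n} (h : s.inDegree i j = 2)
    (hlt : s.left i j = s.top i j) : s.bottom i j = s.right i j := by
  unfold inDegree at h
  revert h hlt
  cases s.left i j <;> cases s.top i j <;> cases s.right i j <;> cases s.bottom i j <;> simp

theorem IsState.addFrozen {s : Orientation n} (h : s.IsState) : s.addFrozen.IsState := by
  obtain ⟨h, hl, hr, ht, hb⟩ := h
  refine ⟨Fin.cases (Fin.cases rfl fun j => ?_) fun i => Fin.cases ?_ fun j => h i j,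
    Fin.cases rfl fun _ => rfl, Fin.cases rfl hr, fun _ => rfl, Fin.cases rfl hb⟩
  · simp [inDegree, Orientation.addFrozen, left, right, top, bottom, ht]
  · simp [inDegree, Orientation.addFrozen, left, right, top, bottom, hl]

theorem IsState.right_eq_false_of_firstRow {s : Orientation (n + 1)} (h : s.IsState)
    (h0 : s.right 0 0 = false) (j : Fin (n + 1)) : s.right 0 j = false := by
  obtain ⟨h, -, -, ht, -⟩ := h
  induction j using Fin.induction with
  | zero => exact h0
  | succ j ih =>
    have hl : s.left 0 j.succ = false := ih
    exact (right_eq_left_and_bottom_eq_top (h 0 j.succ) (by simp [hl, ht, top])).1.trans hl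

theorem IsState.bottom_eq_true_of_firstRow {s : Orientation (n + 1)} (h : s.IsState)
    (h0 : s.right 0 0 = false) (j : Fin n) : s.bottom 0 j.succ = true := by
  have hl : s.left 0 j.succ = false := h.right_eq_false_of_firstRow h0 j.castSucc
  have ht : s.top 0 j.succ = true := h.2.2.2.1 j.succ
  exact (right_eq_left_and_bottom_eq_top (h.1 0 j.succ) (by simp [hl, ht])).2.trans ht

theorem IsState.bottom_eq_false_of_firstColumn {s : Orientation (n + 1)} (h : s.IsState)
    (h0 : s.right 0 0 = false) (i : Fin (n + 1)) : s.bottom i 0 = false := by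
  obtain ⟨h, hl, -, ht, -⟩ := h
  induction i using Fin.induction with
  | zero => exact (bottom_eq_right (h 0 0) ((hl 0).trans (ht 0).symm)).trans h0
  | succ i ih =>
    have ht : s.top i.succ 0 = false := ih
    exact (right_eq_left_and_bottom_eq_top (h i.succ 0) (by simp [ht, hl, left])).2.trans ht

theorem IsState.right_eq_true_of_firstColumn {s : Orientation (n + 1)} (h : s.IsState)
    (h0 : s.right 0 0 = false) (i : Fin n) : s.right i.succ 0 = true := by
  have ht : s.top i.succ 0 = false := h.bottom_eq_false_of_firstColumn h0 i.castSucc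
  have hl : s.left i.succ 0 = true := h.2.1 i.succ
  exact (right_eq_left_and_bottom_eq_top (h.1 i.succ 0) (by simp [hl, ht])).1.trans hl

theorem IsState.removeCorner {s : Orientation (n + 1)} (h : s.IsState)
    (h0 : s.right 0 0 = false) : s.removeCorner.IsState :=
  ⟨fun i j => h.1 i.succ j.succ, h.right_eq_true_of_firstColumn h0, fun i => h.2.2.1 i.succ,
    h.bottom_eq_true_of_firstRow h0, fun j => h.2.2.2.2 j.succ⟩

theorem IsState.addFrozen_removeCorner {s : Orientation (n + 1)} (h : s.IsState)
    (h0 : s.right 0 0 = false) : s.removeCorner.addFrozen = s := by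
  refine Prod.ext (funext₂ ?_) (funext₂ ?_)
  · exact Fin.cases
      (Fin.cases (h.2.1 0).symm fun j => (h.right_eq_false_of_firstRow h0 j).symm)
      fun i => Fin.cases (h.2.1 i.succ).symm fun j => rfl
  · exact Fin.cases (fun j => (h.2.2.2.1 j).symm)
      fun i => Fin.cases (h.bottom_eq_false_of_firstColumn h0 i).symm fun j => rfl

theorem IsState.weight_addFrozen {s : Orientation n} (h : s.IsState) (a : ℂ)
    (x y : Fin (n + 1) → ℂ) :
    s.addFrozen.weight a x y =
      sigma (a ^ 2) * (∏ j : Fin n, sigma (a * (x 0 / y j.succ)⁻¹)) *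
        (∏ i : Fin n, sigma (a * (x i.succ / y 0)⁻¹)) *
          s.weight a (fun i => x i.succ) (fun j => y j.succ) := by
  obtain ⟨-, hl, -, ht, -⟩ := h
  simp only [weight, Fin.prod_univ_succ (n := n), Finset.prod_mul_distrib]
  simp only [vertexWeight, left, right, top, bottom, Orientation.addFrozen, Fin.castSucc_zero,
    Fin.castSucc_succ, Fin.cons_zero, Fin.cons_succ, hl, ht]
  ring

theorem IsState.weight_eq_zero {s : Orientation (n + 1)} (h : s.IsState) {a : ℂ}
    {x y : Fin (n + 1) → ℂ} (hxy : a * (x 0 / y 0) = 1) (h0 : s.right 0 0 = true) :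
    s.weight a x y = 0 := by
  refine Finset.prod_eq_zero (Finset.mem_univ 0) (Finset.prod_eq_zero (Finset.mem_univ 0) ?_)
  have hl : s.left 0 0 = true := h.2.1 0
  have ht : s.top 0 0 = true := h.2.2.2.1 0
  rw [bottom_eq_right (h.1 0 0) (hl.trans ht.symm), hl, ht, h0]
  simp only [vertexWeight, hxy, sigma_one]

end Orientation

/-- At `a x₀ / y₀ = 1` both lines turn at the corner vertex, which freezes its row and column. -/
theorem partitionFunction_corner {a : ℂ} {x y : Fin (n + 1) → ℂ} (hxy : a * (x 0 / y 0) = 1) :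
    partitionFunction (n + 1) a x y =
      sigma (a ^ 2) * (∏ j : Fin n, sigma (a * (x 0 / y j.succ)⁻¹)) *
        (∏ i : Fin n, sigma (a * (x i.succ / y 0)⁻¹)) *
          partitionFunction n a (fun i => x i.succ) (fun j => y j.succ) := by
  rw [partitionFunction, partitionFunction, Finset.mul_sum]
  refine (Finset.sum_of_injOn Orientation.addFrozen Orientation.addFrozen_injective.injOn
    (fun s hs => ?_) (fun s hs hns => ?_) fun s hs => ?_).symm
  · simp only [Finset.coe_filter_univ, Set.mem_ofPred_eq] at hs ⊢
    exact hs.addFrozen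
  · rw [Finset.mem_filter_univ] at hs
    refine hs.weight_eq_zero hxy (Bool.eq_true_of_not_eq_false fun h0 => hns ?_)
    exact ⟨s.removeCorner, by simpa using hs.removeCorner h0, hs.addFrozen_removeCorner h0⟩
  · rw [Finset.mem_filter_univ] at hs
    exact (hs.weight_addFrozen a x y).symm

end Corner

open Polynomial in
/-- Away from `0`, the function `f` is a linear combination of `x ^ d, x ^ (d - 2), …, x ^ (-d)`.
The value at `0` is irrelevant. -/
def IsLaurent {K : Type*} [Field K] (d : ℕ) (f : K → K) : Prop :=
  ∃ p : K[X], p.natDegree ≤ d ∧ ∀ x ≠ 0, x ^ d * f x = p.eval (x ^ 2)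

namespace IsLaurent

open Polynomial

variable {K ι : Type*} [Field K] {d e : ℕ} {f g : K → K}

theorem const (c : K) : IsLaurent 0 fun _ => c := ⟨C c, by simp, by simp⟩

theorem zero (d : ℕ) : IsLaurent d fun _ : K => 0 := ⟨0, by simp, by simp⟩

theorem add (hf : IsLaurent d f) (hg : IsLaurent d g) : IsLaurent d fun x => f x + g x := by
  obtain ⟨p, hp, hfp⟩ := hf
  obtain ⟨q, hq, hgq⟩ := hg
  exact ⟨p + q, natDegree_add_le_of_degree_le hp hq,
    fun x hx => by rw [mul_add, hfp x hx, hgq x hx, eval_add]⟩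

theorem mul (hf : IsLaurent d f) (hg : IsLaurent e g) : IsLaurent (d + e) fun x => f x * g x := by
  obtain ⟨p, hp, hfp⟩ := hf
  obtain ⟨q, hq, hgq⟩ := hg
  exact ⟨p * q, natDegree_mul_le_of_le hp hq,
    fun x hx => by rw [eval_mul, ← hfp x hx, ← hgq x hx, pow_add, mul_mul_mul_comm]⟩

theorem const_mul (c : K) (hf : IsLaurent d f) : IsLaurent d fun x => c * f x := by
  simpa using (const c).mul hf

theorem sub (hf : IsLaurent d f) (hg : IsLaurent d g) : IsLaurent d fun x => f x - g x := by
  simpa [sub_eq_add_neg] using hf.add (hg.const_mul (-1))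

theorem sum {f : ι → K → K} (s : Finset ι) (h : ∀ i ∈ s, IsLaurent d (f i)) :
    IsLaurent d fun x => ∑ i ∈ s, f i x := by
  induction s using Finset.cons_induction with
  | empty => simpa using zero d
  | cons i s hi ih =>
    simp only [Finset.sum_cons]
    exact (h i (by simp)).add (ih fun j hj => h j (by simp [hj]))

theorem prod {d : ι → ℕ} {f : ι → K → K} (s : Finset ι) (h : ∀ i ∈ s, IsLaurent (d i) (f i)) :
    IsLaurent (∑ i ∈ s, d i) fun x => ∏ i ∈ s, f i x := by
  induction s using Finset.cons_induction with
  | empty => simpa using const 1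
  | cons i s hi ih =>
    simp only [Finset.sum_cons, Finset.prod_cons]
    exact (h i (by simp)).mul (ih fun j hj => h j (by simp [hj]))

theorem zpow {k : ℕ} (hk : k ≤ d) : IsLaurent d fun x : K => x ^ ((d : ℤ) - 2 * k) := by
  refine ⟨X ^ (d - k), by simp, fun x hx => ?_⟩
  rw [eval_pow, eval_X, ← zpow_natCast, ← zpow_add₀ hx, ← pow_mul, ← zpow_natCast]
  congr 1
  omega

theorem linear (b c : K) : IsLaurent 1 fun x => b * x + c * x⁻¹ := by
  simpa using ((zpow (d := 1) zero_le_one).const_mul b).add ((zpow (d := 1) le_rfl).const_mul c)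

theorem eq_zero [Fintype ι] (hf : IsLaurent d f) (z : ι → K) (hcard : d < Fintype.card ι)
    (hz : ∀ i, z i ≠ 0) (hinj : Function.Injective fun i => z i ^ 2) (h : ∀ i, f (z i) = 0)
    {x : K} (hx : x ≠ 0) : f x = 0 := by
  obtain ⟨p, hp, hfp⟩ := hf
  have hp0 : p = 0 := eq_zero_of_natDegree_lt_card_of_eval_eq_zero p hinj
    (fun i => by rw [← hfp _ (hz i), h, mul_zero]) (hp.trans_lt hcard)
  have hfx := hfp x hx
  rw [hp0, eval_zero] at hfx
  exact (mul_eq_zero.1 hfx).resolve_left (pow_ne_zero d hx)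

end IsLaurent

section PartitionFunctionIsLaurent

theorem isLaurent_sigma_mul (c : ℂ) : IsLaurent 1 fun x => sigma (c * x) := by
  simpa [sigma, mul_comm, sub_eq_add_neg] using IsLaurent.linear c (-c⁻¹)

theorem isLaurent_sigma_mul_inv (c : ℂ) : IsLaurent 1 fun x => sigma (c * x⁻¹) := by
  simpa [sigma, mul_comm, sub_eq_neg_add] using IsLaurent.linear (-c⁻¹) c

theorem isLaurent_vertexWeight (a y : ℂ) (l r t b : Bool) :
    IsLaurent (1 + r.toNat - l.toNat) fun x => vertexWeight a (x / y) l r t b := by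
  have const_two (c : ℂ) : IsLaurent 2 fun _ => c := by
    simpa using (IsLaurent.zpow (d := 2) one_le_two).const_mul c
  have diagonal : IsLaurent 1 fun x => sigma (a * (x / y)) := by
    simpa only [div_eq_mul_inv, mul_comm _ y⁻¹, ← mul_assoc] using isLaurent_sigma_mul (a * y⁻¹)
  have antidiagonal : IsLaurent 1 fun x => sigma (a * (x / y)⁻¹) := by
    simpa only [div_eq_mul_inv, mul_inv_rev, inv_inv, ← mul_assoc] using
      isLaurent_sigma_mul_inv (a * y)
  cases l <;> cases r <;> cases t <;> cases b <;>
    simp only [vertexWeight, Bool.toNat_true, Bool.toNat_false, Nat.reduceAdd, Nat.reduceSub,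
      IsLaurent.zero, IsLaurent.const, const_two, diagonal, antidiagonal]

theorem sum_one_add_toNat_sub_toNat {m : ℕ} (h : Fin (m + 1) → Bool) :
    ∑ j : Fin m, (1 + (h j.succ).toNat - (h j.castSucc).toNat) + (h 0).toNat =
      m + (h (Fin.last m)).toNat := by
  induction m with
  | zero => simp
  | succ m ih =>
    have hih := ih fun j => h j.castSucc
    have hle := Bool.toNat_le (h (Fin.last m).castSucc)
    simp only [Fin.sum_univ_castSucc, Fin.succ_castSucc, Fin.succ_last, Fin.castSucc_zero,
      Nat.succ_eq_add_one] at hih ⊢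
    omega

theorem isLaurent_partitionFunction {n : ℕ} (a : ℂ) (x y : Fin (n + 1) → ℂ) :
    IsLaurent n fun t => partitionFunction (n + 1) a (Function.update x 0 t) y := by
  refine IsLaurent.sum _ fun s hs => ?_
  obtain ⟨-, hl, hr, -⟩ := (Finset.mem_filter_univ s).1 hs
  have row_degree :
      ∑ j, (1 + (s.right 0 j).toNat - (s.left 0 j).toNat) = n := by
    have := sum_one_add_toNat_sub_toNat (s.1 0)
    rw [hl, hr, Bool.toNat_true, Bool.toNat_false] at this
    exact Nat.add_right_cancel this
  have row := IsLaurent.prod Finset.univ fun j _ => isLaurent_vertexWeight a (y j)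
    (s.left 0 j) (s.right 0 j) (s.top 0 j) (s.bottom 0 j)
  rw [row_degree] at row
  simp only [Orientation.weight, Fin.prod_univ_succ (f := fun _ => ∏ _, _), Function.update_self,
    Function.update_of_ne (Fin.succ_ne_zero _)]
  exact row.mul (IsLaurent.const _)

end PartitionFunctionIsLaurent

section Sigma

variable {m : ℕ}

theorem sigma_inv (x : ℂ) : sigma x⁻¹ = -sigma x := by simp [sigma]

theorem sigma_neg (x : ℂ) : sigma (-x) = -sigma x := by simp [sigma, inv_neg, neg_add_eq_sub]

theorem sigma_eq_zero_iff {x : ℂ} (hx : x ≠ 0) : sigma x = 0 ↔ x ^ 2 = 1 := by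
  rw [sigma, sub_eq_zero, ← mul_eq_one_iff_eq_inv₀ hx, pow_two]

/-- The Vandermonde-type product `∏_{μ < ν} σ(u_μ / u_ν)`. -/
noncomputable def sigmaProd (u : Fin m → ℂ) : ℂ :=
  ∏ μ : Fin m, ∏ ν ∈ Finset.Ioi μ, sigma (u μ * (u ν)⁻¹)

theorem sigmaProd_succ (u : Fin (m + 1) → ℂ) :
    sigmaProd u = (∏ ν : Fin m, sigma (u 0 / u ν.succ)) * sigmaProd fun ν => u ν.succ := by
  simp only [sigmaProd, Fin.prod_univ_succ (n := m) (f := fun _ => ∏ _ ∈ _, _), Fin.prod_Ioi_zero,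
    Fin.prod_Ioi_succ, div_eq_mul_inv]

theorem sigmaProd_comp_perm (u : Fin m → ℂ) (τ : Equiv.Perm (Fin m)) :
    sigmaProd (u ∘ τ) = (Equiv.Perm.sign τ : ℂ) * sigmaProd u :=
  τ.prod_Ioi_comp_eq_sign_mul_prod (f := fun μ ν => sigma (u μ * (u ν)⁻¹)) fun μ ν => by
    rw [← sigma_inv, mul_inv, inv_inv, mul_comm]

theorem sigmaProd_ne_zero {u : Fin m → ℂ} (hu : ∀ μ, u μ ≠ 0)
    (hne : ∀ μ ν, μ < ν → u μ ^ 2 ≠ u ν ^ 2) : sigmaProd u ≠ 0 := by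
  refine Finset.prod_ne_zero_iff.2 fun μ _ => Finset.prod_ne_zero_iff.2 fun ν hν => ?_
  rw [Ne, sigma_eq_zero_iff (mul_ne_zero (hu μ) (inv_ne_zero (hu ν))), mul_pow, inv_pow,
    mul_inv_eq_one₀ (pow_ne_zero 2 (hu ν))]
  exact hne μ ν (Finset.mem_Ioi.1 hν)

end Sigma

section SixthRoot

variable {a : ℂ}

theorem pow_three_eq_neg_one (ha : IsPrimitiveRoot a 6) : a ^ 3 = -1 :=
  (ha.pow (by norm_num) (by norm_num : 6 = 3 * 2)).eq_neg_one_of_two_right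

theorem sq_eq_sub_one (ha : IsPrimitiveRoot a 6) : a ^ 2 = a - 1 := by
  have h := ha.isRoot_cyclotomic (by norm_num)
  simp only [Polynomial.cyclotomic_six, Polynomial.IsRoot.def, Polynomial.eval_add,
    Polynomial.eval_sub, Polynomial.eval_pow, Polynomial.eval_X, Polynomial.eval_one] at h
  linear_combination h

theorem sq_eq_neg_inv (ha : IsPrimitiveRoot a 6) : a ^ 2 = -a⁻¹ := by
  have ha0 := ha.ne_zero (by norm_num)
  field_simp
  exact pow_three_eq_neg_one ha

theorem sigma_sq (ha : IsPrimitiveRoot a 6) : sigma (a ^ 2) = sigma a := by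
  rw [sq_eq_neg_inv ha, sigma_neg, sigma_inv, neg_neg]

theorem sigma_mul_sigma_mul_sigma (ha : IsPrimitiveRoot a 6) (z : ℂ) :
    sigma (a⁻¹ * z) * (sigma z * sigma (a * z)) = sigma (z ^ 3) := by
  have hsq := sq_eq_sub_one ha
  have hinv : a⁻¹ = 1 - a := inv_eq_of_mul_eq_one_right (by linear_combination -hsq)
  simp only [sigma, mul_inv, inv_inv, ← inv_pow]
  rw [hinv]
  linear_combination -((z ^ 2 + 2 * z * z⁻¹ + z⁻¹ ^ 2) * (z - z⁻¹)) * hsq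

end SixthRoot

section Indices

variable {n : ℕ}

/-- The position of the spectral parameter `x i` in the combined vector `u`. -/
def rowIndex (i : Fin n) : Fin (2 * n) := ⟨2 * i.val, by omega⟩

/-- The position of the spectral parameter `y j` in the combined vector `u`. -/
def colIndex (j : Fin n) : Fin (2 * n) := ⟨2 * j.val + 1, by omega⟩

theorem partitionFunctionCombined_eq (a : ℂ) (u : Fin (2 * n) → ℂ) :
    partitionFunctionCombined n a u = partitionFunction n a (u ∘ rowIndex) (u ∘ colIndex) := rfl

theorem rowIndex_injective : Function.Injective (rowIndex (n := n)) := fun i j h =>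
  Fin.ext (by simpa [rowIndex] using h)

theorem colIndex_injective : Function.Injective (colIndex (n := n)) := fun i j h =>
  Fin.ext (by simpa [colIndex] using h)

theorem rowIndex_ne_colIndex (i j : Fin n) : rowIndex i ≠ colIndex j := fun h => by
  have := congrArg Fin.val h
  simp only [rowIndex, colIndex] at this
  omega

theorem swap_colIndex_apply_zero (i j : Fin (n + 1)) :
    Equiv.swap (colIndex i) (colIndex j) (0 : Fin (2 * n + 2)) = 0 :=
  Equiv.swap_apply_of_ne_of_ne (rowIndex_ne_colIndex (0 : Fin (n + 1)) i)
    (rowIndex_ne_colIndex (0 : Fin (n + 1)) j)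

theorem prod_eq_prod_rowIndex_mul_prod_colIndex {M : Type*} [CommMonoid M] {n : ℕ}
    (f : Fin (2 * n) → M) : ∏ ν, f ν = (∏ i, f (rowIndex i)) * ∏ j, f (colIndex j) := by
  induction n with
  | zero => simp
  | succ n ih =>
    refine (Fin.prod_univ_succ (n := 2 * n + 1) f).trans ?_
    rw [Fin.prod_univ_succ (n := 2 * n), ih fun ν => f ν.succ.succ, Fin.prod_univ_succ (n := n),
      Fin.prod_univ_succ (n := n), ← mul_assoc, mul_mul_mul_comm]
    rfl

end Indices

section CornerRecursions

variable {n : ℕ} {a : ℂ} {u : Fin (2 * n + 2) → ℂ}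

theorem partitionFunctionCombined_succ (a : ℂ) (u : Fin (2 * n + 2) → ℂ) :
    partitionFunctionCombined (n + 1) a u =
      partitionFunction (n + 1) a (Fin.cons (u 0) fun i => u (rowIndex i).succ.succ)
        (Fin.cons (u 1) fun j => u (colIndex j).succ.succ) :=
  congrArg₂ (partitionFunction (n + 1) a) (funext (Fin.cases rfl fun _ => rfl))
    (funext (Fin.cases rfl fun _ => rfl))

theorem partitionFunctionCombined_corner (ha : IsPrimitiveRoot a 6) (hu : ∀ μ, u μ ≠ 0)
    (h1 : u 1 = a * u 0) :
    partitionFunctionCombined (n + 1) a u =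
      sigma a * (∏ ν : Fin (2 * n), sigma (a⁻¹ * (u 0 / u ν.succ.succ))) *
        partitionFunctionCombined n a fun ν => u ν.succ.succ := by
  have hxy : a * (u 0 / u 1) = 1 := by rw [h1, ← mul_div_assoc, div_self (h1 ▸ hu 1)]
  have column_factor (w : ℂ) : sigma (a * (u 0 / w)⁻¹) = -sigma (a⁻¹ * (u 0 / w)) := by
    rw [← sigma_inv, mul_inv, inv_inv]
  have row_factor (w : ℂ) : sigma (a * (w / u 1)⁻¹) = -sigma (a⁻¹ * (u 0 / w)) := by
    rw [h1, inv_div, mul_div_assoc, ← mul_assoc, ← pow_two, sq_eq_neg_inv ha, neg_mul, sigma_neg]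
  rw [partitionFunctionCombined_succ, partitionFunction_corner (by exact hxy),
    prod_eq_prod_rowIndex_mul_prod_colIndex, sigma_sq ha, partitionFunctionCombined_eq]
  simp only [Fin.cons_zero, Fin.cons_succ, column_factor, row_factor, Finset.prod_neg,
    Function.comp_def]
  rcases neg_one_pow_eq_or ℂ n with sign | sign <;>
    simp only [Finset.card_univ, Fintype.card_fin, sign] <;> ring

theorem sigmaProd_corner (hu : ∀ μ, u μ ≠ 0) (h1 : u 1 = a * u 0) :
    sigmaProd u = -sigma a *
      (∏ ν : Fin (2 * n), sigma (u 0 / u ν.succ.succ) * sigma (a * (u 0 / u ν.succ.succ))) *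
        sigmaProd fun ν => u ν.succ.succ := by
  have ratio : u 0 / u 1 = a⁻¹ := by rw [h1, div_mul_cancel_right₀ (hu 0)]
  rw [sigmaProd_succ, sigmaProd_succ, Fin.prod_univ_succ, Fin.succ_zero_eq_one, ratio, sigma_inv,
    h1, Finset.prod_mul_distrib]
  simp only [mul_div_assoc, mul_assoc]

theorem nonMultipleOfThree_add_two (r : ℕ) :
    nonMultipleOfThree (r + 2) = nonMultipleOfThree r + 3 := by
  simp only [nonMultipleOfThree]
  omega

theorem zpow_add_mul_zpow_lagged {c z : ℂ} (hc : c ≠ 0) (hz : z ≠ 0) (n r : ℕ) :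
    z ^ (3 * ((n + 1 : ℕ) : ℤ) - 2 * (nonMultipleOfThree (r + 2) : ℤ)) +
        -(c ^ 6)⁻¹ * z ^ (3 * ((n + 1 : ℕ) : ℤ) - 2 * (nonMultipleOfThree r : ℤ)) =
      (c ^ 3)⁻¹ * sigma ((c / z) ^ 3) * z ^ (3 * (n : ℤ) - 2 * (nonMultipleOfThree r : ℤ)) := by
  have row : 3 * ((n + 1 : ℕ) : ℤ) - 2 * (nonMultipleOfThree (r + 2) : ℤ) =
      3 * (n : ℤ) - 2 * (nonMultipleOfThree r : ℤ) - 3 := by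
    rw [nonMultipleOfThree_add_two]
    push_cast
    ring
  have lagged_row : 3 * ((n + 1 : ℕ) : ℤ) - 2 * (nonMultipleOfThree r : ℤ) =
      3 * (n : ℤ) - 2 * (nonMultipleOfThree r : ℤ) + 3 := by
    push_cast
    ring
  rw [row, lagged_row, zpow_sub₀ hz, zpow_add₀ hz, sigma]
  norm_cast
  field_simp
  ring

theorem det_matrixP_cornerBlock (ha : IsPrimitiveRoot a 6) (h0 : u 0 ≠ 0) (h1 : u 1 = a * u 0) :
    ((matrixP (n + 1) u).submatrix (Fin.castLE (Nat.le_add_left 2 (2 * n)))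
      (Fin.castLE (Nat.le_add_left 2 (2 * n)))).det = -((-1) ^ n * sigma a) * u 0 ^ (6 * n) := by
  have ha0 : a ≠ 0 := ha.ne_zero (by norm_num)
  have exponent_zero : 3 * ((n + 1 : ℕ) : ℤ) - 2 * (nonMultipleOfThree 0 : ℤ) = 3 * n + 1 := by
    simp only [nonMultipleOfThree]
    omega
  have exponent_one : 3 * ((n + 1 : ℕ) : ℤ) - 2 * (nonMultipleOfThree 1 : ℤ) = 3 * n - 1 := by
    simp only [nonMultipleOfThree]
    omega
  rw [Matrix.det_fin_two]
  change u 0 ^ (_ - 2 * (nonMultipleOfThree 0 : ℤ)) * u 1 ^ (_ - 2 * (nonMultipleOfThree 1 : ℤ)) -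
    u 1 ^ (_ - 2 * (nonMultipleOfThree 0 : ℤ)) * u 0 ^ (_ - 2 * (nonMultipleOfThree 1 : ℤ)) = _
  rw [exponent_zero, exponent_one, h1, mul_zpow, mul_zpow, zpow_add₀ h0, zpow_sub₀ h0,
    zpow_add₀ ha0, zpow_sub₀ ha0, zpow_mul, zpow_mul]
  simp only [zpow_ofNat, zpow_natCast]
  rw [pow_three_eq_neg_one ha, sigma, show 6 * n = 3 * n + 3 * n by ring, pow_add, pow_mul]
  field_simp
  ring

theorem det_matrixP_corner (ha : IsPrimitiveRoot a 6) (hu : ∀ μ, u μ ≠ 0) (h1 : u 1 = a * u 0) :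
    (matrixP (n + 1) u).det = -((-1) ^ n * sigma a) *
      (∏ ν : Fin (2 * n), sigma ((u 0 / u ν.succ.succ) ^ 3)) *
        (matrixP n fun ν => u ν.succ.succ).det := by
  have sigma_ratio_eq_zero (s : Fin 2) :
      sigma ((u 0 / u (s.castLE (Nat.le_add_left 2 (2 * n)))) ^ 3) = 0 := by
    fin_cases s
    · change sigma ((u 0 / u 0) ^ 3) = 0
      rw [div_self (hu 0), one_pow, sigma_one]
    · change sigma ((u 0 / u 1) ^ 3) = 0
      rw [h1, div_mul_cancel_right₀ (hu 0), inv_pow, sigma_inv, pow_three_eq_neg_one ha, sigma_neg,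
        sigma_one, neg_zero, neg_zero]
  refine (det_eq_det_mul_det_of_lagged_row_add_eq_zero two_ne_zero (matrixP (n + 1) u)
    (-(u 0 ^ 6)⁻¹) fun r s => (zpow_add_mul_zpow_lagged (hu 0) (hu _) n r).trans ?_).trans ?_
  · rw [sigma_ratio_eq_zero, mul_zero, zero_mul]
  have lagged_rows : (Matrix.of fun r s : Fin (2 * n) => matrixP (n + 1) u (r.addNat 2) (s.addNat 2)
      + -(u 0 ^ 6)⁻¹ * matrixP (n + 1) u (r.castAdd 2) (s.addNat 2)) =
      Matrix.of fun r s => (u 0 ^ 3)⁻¹ * sigma ((u 0 / u s.succ.succ) ^ 3) *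
        matrixP n (fun ν => u ν.succ.succ) r s :=
    Matrix.ext fun r s => zpow_add_mul_zpow_lagged (hu 0) (hu s.succ.succ) n r
  refine (congrArg₂ (· * ·) (det_matrixP_cornerBlock ha (hu 0) h1)
    (congrArg Matrix.det lagged_rows)).trans ?_
  have cancel : u 0 ^ (6 * n) * (u 0 ^ 3)⁻¹ ^ (2 * n) = 1 := by
    rw [inv_pow, ← pow_mul, show 3 * (2 * n) = 6 * n by ring,
      mul_inv_cancel₀ (pow_ne_zero _ (hu 0))]
  rw [Matrix.det_mul_row, Finset.prod_mul_distrib, Finset.prod_const, Finset.card_univ,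
    Fintype.card_fin, mul_assoc, mul_assoc, ← mul_assoc (u 0 ^ _), cancel, one_mul, mul_assoc]

end CornerRecursions

section Discrepancy

variable {n : ℕ} {a : ℂ}

/-- The difference of the two sides of the determinant formula, after multiplication by the
Vandermonde-type denominator. -/
noncomputable def discrepancy (a : ℂ) (n : ℕ) (u : Fin (2 * n) → ℂ) : ℂ :=
  partitionFunctionCombined n a u * sigmaProd u -
    (-1) ^ (n * (n - 1) / 2) * sigma a ^ n * (matrixP n u).det

theorem discrepancy_zero (a : ℂ) (u : Fin (2 * 0) → ℂ) : discrepancy a 0 u = 0 := by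
  have card_states : ({s | s.IsState} : Finset (Orientation 0)).card = 1 := by decide
  simp [discrepancy, partitionFunctionCombined, partitionFunction, sigmaProd, Orientation.weight,
    card_states]

theorem neg_one_pow_triangular_succ (n : ℕ) :
    (-1 : ℂ) ^ ((n + 1) * (n + 1 - 1) / 2) = (-1) ^ (n * (n - 1) / 2) * (-1) ^ n := by
  rw [← Finset.sum_range_id, ← Finset.sum_range_id, Finset.sum_range_succ, pow_add]

theorem discrepancy_corner {u : Fin (2 * n + 2) → ℂ} (ha : IsPrimitiveRoot a 6)
    (hu : ∀ μ, u μ ≠ 0) (h1 : u 1 = a * u 0) :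
    discrepancy a (n + 1) u =
      -(sigma a ^ 2 * ∏ ν : Fin (2 * n), sigma ((u 0 / u ν.succ.succ) ^ 3)) *
        discrepancy a n fun ν => u ν.succ.succ := by
  have prod_sigma_pow_three : ∏ ν : Fin (2 * n), sigma ((u 0 / u ν.succ.succ) ^ 3) =
      (∏ ν : Fin (2 * n), sigma (a⁻¹ * (u 0 / u ν.succ.succ))) *
        ∏ ν : Fin (2 * n), sigma (u 0 / u ν.succ.succ) * sigma (a * (u 0 / u ν.succ.succ)) := by
    rw [← Finset.prod_mul_distrib]
    exact Finset.prod_congr rfl fun ν _ => (sigma_mul_sigma_mul_sigma ha _).symm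
  have sign_sq : (-1 : ℂ) ^ n * (-1) ^ n = 1 := by rw [← mul_pow, neg_one_mul, neg_neg, one_pow]
  rw [discrepancy, discrepancy, neg_one_pow_triangular_succ,
    partitionFunctionCombined_corner ha hu h1, det_matrixP_corner ha hu h1]
  refine (congrArg (_ * · - _) (sigmaProd_corner hu h1)).trans ?_
  rw [prod_sigma_pow_three]
  linear_combination sigma a ^ (n + 2) * (∏ ν : Fin (2 * n), sigma (a⁻¹ * (u 0 / u ν.succ.succ))) *
    (∏ ν : Fin (2 * n), sigma (u 0 / u ν.succ.succ) * sigma (a * (u 0 / u ν.succ.succ))) *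
    (matrixP n fun ν => u ν.succ.succ).det * (-1) ^ (n * (n - 1) / 2) * sign_sq

theorem discrepancy_eq_zero_of_eq {u : Fin (2 * n + 2) → ℂ} (h0 : u 0 ≠ 0) {ν : Fin (2 * n + 1)}
    (h : u 0 = u ν.succ) : discrepancy a (n + 1) u = 0 := by
  have sigmaProd_eq_zero : sigmaProd u = 0 := by
    rw [sigmaProd_succ, Finset.prod_eq_zero (Finset.mem_univ ν), zero_mul]
    rw [← h, div_self h0, sigma_one]
  have det_eq_zero : (matrixP (n + 1) u).det = 0 :=
    Matrix.det_zero_of_column_eq (i := (0 : Fin (2 * n + 2))) (Fin.succ_ne_zero ν).symm fun r =>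
      congrArg (· ^ (3 * ((n + 1 : ℕ) : ℤ) - 2 * (nonMultipleOfThree r.val : ℤ))) h
  exact sub_eq_zero.2 ((mul_eq_zero_of_right _ sigmaProd_eq_zero).trans
    (mul_eq_zero_of_right _ det_eq_zero).symm)

theorem sigma_sq_mul_div_ne_zero {y y' : ℂ} (ha : IsPrimitiveRoot a 6) (hy : y ≠ 0) (hy' : y' ≠ 0)
    (h : y ^ 6 ≠ y' ^ 6) : sigma (a ^ 2 * (y / y')) ≠ 0 := fun h0 => h <| by
  have ha0 : a ≠ 0 := ha.ne_zero (by norm_num)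
  rw [sigma_eq_zero_iff (mul_ne_zero (pow_ne_zero _ ha0) (div_ne_zero hy hy'))] at h0
  have : (a ^ 6) ^ 2 * (y / y') ^ 6 = 1 := by
    linear_combination ((a ^ 2 * (y / y')) ^ 4 + (a ^ 2 * (y / y')) ^ 2 + 1) * h0
  rwa [ha.pow_eq_one, one_pow, one_mul, div_pow, div_eq_one_iff_eq (pow_ne_zero _ hy')] at this

theorem discrepancy_comp_swap {u : Fin (2 * n) → ℂ} (ha : IsPrimitiveRoot a 6)
    (hu : ∀ μ, u μ ≠ 0) (hne : Function.Injective fun j => u (colIndex j) ^ 6) (i j : Fin n) :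
    discrepancy a n (u ∘ Equiv.swap (colIndex i) (colIndex j)) =
      (Equiv.Perm.sign (Equiv.swap (colIndex i) (colIndex j)) : ℂ) * discrepancy a n u := by
  have row_part : (u ∘ Equiv.swap (colIndex i) (colIndex j)) ∘ rowIndex = u ∘ rowIndex :=
    funext fun k => congrArg u
      (Equiv.swap_apply_of_ne_of_ne (rowIndex_ne_colIndex k i) (rowIndex_ne_colIndex k j))
  have col_part : (u ∘ Equiv.swap (colIndex i) (colIndex j)) ∘ colIndex =
      (u ∘ colIndex) ∘ Equiv.swap i j :=
    funext fun k => congrArg u (colIndex_injective.swap_apply i j k)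
  have partitionFunctionCombined_comp_swap :
      partitionFunctionCombined n a (u ∘ Equiv.swap (colIndex i) (colIndex j)) =
        partitionFunctionCombined n a u := by
    rw [partitionFunctionCombined_eq, row_part, col_part]
    exact partitionFunction_comp_perm (ha.ne_zero (by norm_num)) (fun _ => hu _) (fun _ => hu _)
      (fun k l hkl => sigma_sq_mul_div_ne_zero ha (hu _) (hu _) (hne.ne hkl)) _
  rw [discrepancy, discrepancy, partitionFunctionCombined_comp_swap, sigmaProd_comp_perm,
    show matrixP n (u ∘ _) = (matrixP n u).submatrix id _ from rfl, Matrix.det_permute']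
  ring

theorem discrepancy_eq_zero_of_colIndex_eq {u : Fin (2 * n + 2) → ℂ} (ha : IsPrimitiveRoot a 6)
    (hu : ∀ μ, u μ ≠ 0) (hne : Function.Injective fun j : Fin (n + 1) => u (colIndex j) ^ 6)
    {j : Fin (n + 1)} (hj : u (colIndex j) = a * u 0)
    (h : discrepancy a n (fun ν => u (Equiv.swap (colIndex 0) (colIndex j) ν.succ.succ)) = 0) :
    discrepancy a (n + 1) u = 0 := by
  have swap_one : Equiv.swap (colIndex 0) (colIndex j) (1 : Fin (2 * n + 2)) = colIndex j :=
    Equiv.swap_apply_left _ _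
  have swapped : discrepancy a (n + 1) (u ∘ Equiv.swap (colIndex 0) (colIndex j)) = 0 := by
    refine (discrepancy_corner ha (fun _ => hu _) ?_).trans (mul_eq_zero_of_right _ h)
    exact (congrArg u swap_one).trans
      (hj.trans (congrArg (a * u ·) (swap_colIndex_apply_zero 0 j).symm))
  rw [discrepancy_comp_swap ha hu hne, mul_eq_zero] at swapped
  exact swapped.resolve_left (by exact_mod_cast Units.ne_zero _)

end Discrepancy

section Interpolation

variable {n : ℕ} {a : ℂ}

theorem isLaurent_sigmaProd {m : ℕ} (u : Fin (m + 1) → ℂ) :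
    IsLaurent m fun t => sigmaProd (Function.update u 0 t) := by
  simp only [sigmaProd_succ, Function.update_self, Function.update_of_ne (Fin.succ_ne_zero _),
    div_eq_mul_inv, mul_comm _ (u _)⁻¹]
  simpa using (IsLaurent.prod Finset.univ fun (ν : Fin m) _ =>
    isLaurent_sigma_mul (u ν.succ)⁻¹).mul (IsLaurent.const _)

theorem matrixP_succ_apply (u : Fin (2 * n + 2) → ℂ) (r μ : Fin (2 * n + 2)) :
    matrixP (n + 1) u r μ = u μ ^ (((3 * n + 1 : ℕ) : ℤ) - 2 * (r.val + r.val / 2 : ℕ)) := by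
  change u μ ^ (3 * ((n + 1 : ℕ) : ℤ) - 2 * (nonMultipleOfThree r.val : ℤ)) = _
  congr 1
  simp only [nonMultipleOfThree]
  omega

theorem isLaurent_det_matrixP (u : Fin (2 * n + 2) → ℂ) :
    IsLaurent (3 * n + 1) fun t => (matrixP (n + 1) (Function.update u 0 t)).det := by
  have expansion (t : ℂ) : (matrixP (n + 1) (Function.update u 0 t)).det =
      ∑ r : Fin (2 * n + 2),
        (-1) ^ r.val * ((matrixP (n + 1) u).submatrix r.succAbove Fin.succ).det *
          t ^ (((3 * n + 1 : ℕ) : ℤ) - 2 * (r.val + r.val / 2 : ℕ)) := by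
    refine (Matrix.det_succ_column_zero (n := 2 * n + 1) _).trans
      (Finset.sum_congr rfl fun r _ => ?_)
    have first_column : matrixP (n + 1) (Function.update u 0 t) r (0 : Fin (2 * n + 2)) =
        t ^ (((3 * n + 1 : ℕ) : ℤ) - 2 * (r.val + r.val / 2 : ℕ)) :=
      (matrixP_succ_apply _ r 0).trans (congrArg (· ^ _) (Function.update_self ..))
    have other_columns : (matrixP (n + 1) (Function.update u 0 t)).submatrix r.succAbove Fin.succ =
        (matrixP (n + 1) u).submatrix r.succAbove Fin.succ :=
      Matrix.ext fun _ ν => congrArg (· ^ (_ : ℤ)) (Function.update_of_ne (Fin.succ_ne_zero ν) t u)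
    exact (congrArg₂ (_ * · * ·) first_column (congrArg _ other_columns)).trans
      (mul_right_comm _ _ _)
  simp only [expansion]
  exact IsLaurent.sum _ fun r _ =>
    (IsLaurent.zpow (d := 3 * n + 1) (k := r.val + r.val / 2) (by omega)).const_mul _

theorem isLaurent_partitionFunctionCombined (a : ℂ) (u : Fin (2 * n + 2) → ℂ) :
    IsLaurent n fun t => partitionFunctionCombined (n + 1) a (Function.update u 0 t) := by
  have update_eq (t : ℂ) : partitionFunctionCombined (n + 1) a (Function.update u 0 t) =
      partitionFunction (n + 1) a (Function.update (u ∘ rowIndex (n := n + 1)) 0 t)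
        (u ∘ colIndex (n := n + 1)) :=
    congrArg₂ (partitionFunction (n + 1) a)
      (Function.update_comp_eq_of_injective u rowIndex_injective 0 t)
      (funext fun j => Function.update_of_ne (rowIndex_ne_colIndex (0 : Fin (n + 1)) j).symm t u)
  simp only [update_eq]
  exact isLaurent_partitionFunction a _ _

theorem isLaurent_discrepancy (a : ℂ) (u : Fin (2 * n + 2) → ℂ) :
    IsLaurent (3 * n + 1) fun t => discrepancy a (n + 1) (Function.update u 0 t) := by
  refine IsLaurent.sub ?_ ((isLaurent_det_matrixP u).const_mul _)
  rw [show 3 * n + 1 = n + (2 * n + 1) by ring]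
  exact (isLaurent_partitionFunctionCombined a u).mul (isLaurent_sigmaProd u)

/-- The values of the first spectral parameter at which the discrepancy is seen to vanish: it
coincides with another parameter, or a corner recursion applies. -/
noncomputable def interpolationNode (a : ℂ) (u : Fin (2 * n + 2) → ℂ) :
    Fin (2 * n + 1) ⊕ Fin (n + 1) → ℂ :=
  Sum.elim (fun ν => u ν.succ) fun j => u (colIndex j) / a

theorem interpolationNode_ne_zero {u : Fin (2 * n + 2) → ℂ} (ha : a ≠ 0) (hu : ∀ μ, u μ ≠ 0) :
    ∀ i, interpolationNode a u i ≠ 0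
  | .inl _ => hu _
  | .inr _ => div_ne_zero (hu _) ha

theorem interpolationNode_sq_injective {u : Fin (2 * n + 2) → ℂ} (ha : IsPrimitiveRoot a 6)
    (hu : ∀ μ, u μ ≠ 0) (hne : Function.Injective fun μ => u μ ^ 6) :
    Function.Injective fun i => interpolationNode a u i ^ 2 := by
  have pow_six_eq {x y : ℂ} (h : x ^ 2 = y ^ 2) : x ^ 6 = y ^ 6 := by
    rw [show 6 = 2 * 3 by rfl, pow_mul, pow_mul, h]
  have div_pow_six (y : ℂ) : (y / a) ^ 6 = y ^ 6 := by rw [div_pow, ha.pow_eq_one, div_one]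
  have mixed (ν : Fin (2 * n + 1)) (j : Fin (n + 1)) :
      u ν.succ ^ 2 ≠ (u (colIndex j) / a) ^ 2 := fun h => by
    have same_index : ν.succ = colIndex j := hne ((pow_six_eq h).trans (div_pow_six _))
    rw [same_index, div_pow, eq_div_iff (pow_ne_zero 2 (ha.ne_zero (by norm_num)))] at h
    exact ha.pow_ne_one_of_pos_of_lt two_ne_zero (by norm_num)
      (mul_eq_left₀ (pow_ne_zero 2 (hu _)) |>.1 h)
  rintro (ν | j) (ν' | j') h
  · exact congrArg _ (Fin.succ_injective _ (hne (pow_six_eq h)))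
  · exact (mixed _ _ h).elim
  · exact (mixed _ _ h.symm).elim
  · refine congrArg _ (colIndex_injective (hne ?_))
    exact (div_pow_six _).symm.trans ((pow_six_eq h).trans (div_pow_six _))

theorem discrepancy_eq_zero_of_eq_interpolationNode (ha : IsPrimitiveRoot a 6)
    {u v : Fin (2 * n + 2) → ℂ} (hu : ∀ μ, u μ ≠ 0) (hne : Function.Injective fun μ => u μ ^ 6)
    (ih : ∀ w : Fin (2 * n) → ℂ, (∀ μ, w μ ≠ 0) → (Function.Injective fun μ => w μ ^ 6) →
      discrepancy a n w = 0)
    {i : Fin (2 * n + 1) ⊕ Fin (n + 1)} (hv_zero : v 0 = interpolationNode a u i)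
    (hv : ∀ μ ≠ 0, v μ = u μ) : discrepancy a (n + 1) v = 0 := by
  have ha0 : a ≠ 0 := ha.ne_zero (by norm_num)
  have v_ne_zero (μ) : v μ ≠ 0 := by
    by_cases hμ : μ = 0
    · rw [hμ, hv_zero]
      exact interpolationNode_ne_zero ha0 hu i
    · rw [hv μ hμ]
      exact hu μ
  have v_colIndex (k : Fin (n + 1)) : v (colIndex k) = u (colIndex k) :=
    hv _ (rowIndex_ne_colIndex (0 : Fin (n + 1)) k).symm
  rcases i with ν | j
  · exact discrepancy_eq_zero_of_eq (v_ne_zero 0) (hv_zero.trans (hv _ (Fin.succ_ne_zero ν)).symm)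
  · have v_swap (ν : Fin (2 * n)) : v (Equiv.swap (colIndex 0) (colIndex j) ν.succ.succ) =
        u (Equiv.swap (colIndex 0) (colIndex j) ν.succ.succ) :=
      hv _ fun h => Fin.succ_ne_zero _
        (Equiv.injective _ (h.trans (swap_colIndex_apply_zero 0 j).symm))
    refine discrepancy_eq_zero_of_colIndex_eq ha v_ne_zero ?_ (j := j) ?_
      (ih _ (fun _ => v_ne_zero _) ?_)
    · simp only [v_colIndex]
      exact hne.comp colIndex_injective
    · rw [v_colIndex, hv_zero]
      exact (mul_div_cancel₀ _ ha0).symm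
    · simp only [v_swap]
      exact hne.comp ((Equiv.injective _).comp
        ((Fin.succ_injective _).comp (Fin.succ_injective _)))

theorem discrepancy_eq_zero_of_injective_pow (ha : IsPrimitiveRoot a 6) {n : ℕ}
    (u : Fin (2 * n) → ℂ) (hu : ∀ μ, u μ ≠ 0) (hne : Function.Injective fun μ => u μ ^ 6) :
    discrepancy a n u = 0 := by
  induction n with
  | zero => exact discrepancy_zero a u
  | succ n ih =>
    change Fin (2 * n + 2) → ℂ at u
    rw [← Function.update_eq_self (0 : Fin (2 * n + 2)) u]
    refine (isLaurent_discrepancy a u).eq_zero (interpolationNode a u) ?_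
      (interpolationNode_ne_zero (ha.ne_zero (by norm_num)) hu)
      (interpolationNode_sq_injective ha hu hne) (fun i => ?_) (hu 0)
    · simp only [Fintype.card_sum, Fintype.card_fin]
      omega
    · exact discrepancy_eq_zero_of_eq_interpolationNode ha hu hne ih (Function.update_self ..)
        fun μ hμ => Function.update_of_ne hμ _ u

end Interpolation

section Density

open Filter Topology

variable {X : Type*} [TopologicalSpace X] {f : X → ℂ} {x₀ : X}

theorem continuousAt_sigma_comp (hf : ContinuousAt f x₀) (h0 : f x₀ ≠ 0) :
    ContinuousAt (fun x => sigma (f x)) x₀ :=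
  hf.sub (hf.inv₀ h0)

theorem continuousAt_vertexWeight_comp {a : ℂ} (ha : a ≠ 0) (hf : ContinuousAt f x₀)
    (h0 : f x₀ ≠ 0) (l r t b : Bool) : ContinuousAt (fun x => vertexWeight a (f x) l r t b) x₀ := by
  have diagonal := continuousAt_sigma_comp (hf.const_mul a) (mul_ne_zero ha h0)
  have antidiagonal :=
    continuousAt_sigma_comp ((hf.inv₀ h0).const_mul a) (mul_ne_zero ha (inv_ne_zero h0))
  cases l <;> cases r <;> cases t <;> cases b <;>
    first | exact continuousAt_const | exact diagonal | exact antidiagonal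

theorem continuousAt_discrepancy {n : ℕ} {a : ℂ} (ha : a ≠ 0) {u : Fin (2 * n) → ℂ}
    (hu : ∀ μ, u μ ≠ 0) : ContinuousAt (discrepancy a n) u := by
  have coord (μ) : ContinuousAt (fun v : Fin (2 * n) → ℂ => v μ) u := continuousAt_apply μ u
  have partitionFunctionCombined_part : ContinuousAt (partitionFunctionCombined n a) u :=
    tendsto_finsetSum _ fun s _ => tendsto_finsetProd _ fun i _ => tendsto_finsetProd _ fun j _ =>
      continuousAt_vertexWeight_comp ha ((coord (rowIndex i)).div (coord (colIndex j)) (hu _))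
        (div_ne_zero (hu _) (hu _)) _ _ _ _
  have sigmaProd_part : ContinuousAt (sigmaProd (m := 2 * n)) u :=
    tendsto_finsetProd _ fun μ _ => tendsto_finsetProd _ fun ν _ =>
      continuousAt_sigma_comp ((coord μ).mul ((coord ν).inv₀ (hu ν)))
        (mul_ne_zero (hu μ) (inv_ne_zero (hu ν)))
  have matrixP_part : ContinuousAt (matrixP n) u :=
    continuousAt_pi.2 fun r => continuousAt_pi.2 fun μ => (coord μ).zpow₀ _ (Or.inl (hu μ))
  have det_part : ContinuousAt (fun v => (matrixP n v).det) u :=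
    (Continuous.matrix_det continuous_id).continuousAt.comp matrixP_part
  exact (partitionFunctionCombined_part.mul sigmaProd_part).sub (continuousAt_const.mul det_part)

theorem discrepancy_eq_zero {n : ℕ} {a : ℂ} (ha : IsPrimitiveRoot a 6) {u : Fin (2 * n) → ℂ}
    (hu : ∀ μ, u μ ≠ 0) : discrepancy a n u = 0 :=
  tendsto_nhds_unique_of_frequently_eq (continuousAt_discrepancy (ha.ne_zero (by norm_num)) hu)
    tendsto_const_nhds ((frequently_nhds_injective_pow hu (by norm_num : 6 ≠ 0)).mono
      fun _ hv => discrepancy_eq_zero_of_injective_pow ha _ hv.1 hv.2)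

end Density

end SquareIce

theorem theoremt_general (n : ℕ) (a : ℂ) (ha : IsPrimitiveRoot a 6) (u : Fin (2 * n) → ℂ)
    (hu : ∀ μ, u μ ≠ 0) :
    SquareIce.partitionFunctionCombined n a u *
        ∏ μ : Fin (2 * n), ∏ ν ∈ Finset.Ioi μ, SquareIce.sigma (u μ * (u ν)⁻¹) =
      (-1) ^ (n * (n - 1) / 2) * SquareIce.sigma a ^ n * (SquareIce.matrixP n u).det :=
  sub_eq_zero.1 (SquareIce.discrepancy_eq_zero ha hu)

/-- For `a = exp(iπ/3)`, at all nonzero spectral parameters at which the denominator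
`∏_{μ<ν} σ(u_μ / u_ν)` does not vanish. -/
theorem theoremt (n : ℕ) (a : ℂ) (ha : a = Complex.exp (Complex.I * Real.pi / 3))
    (u : Fin (2 * n) → ℂ) (hu : ∀ μ, u μ ≠ 0)
    (hne : ∀ μ ν, μ < ν → u μ ^ 2 ≠ u ν ^ 2) :
    SquareIce.partitionFunctionCombined n a u =
      (-1) ^ (n * (n - 1) / 2) *
        (SquareIce.sigma a ^ n /
          ∏ μ : Fin (2 * n), ∏ ν ∈ Finset.Ioi μ, SquareIce.sigma (u μ * (u ν)⁻¹)) *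
        (SquareIce.matrixP n u).det := by
  have ha_primitive : IsPrimitiveRoot a 6 := by
    convert Complex.isPrimitiveRoot_exp 6 (by norm_num) using 1
    rw [ha]
    congr 1
    push_cast
    ring
  rw [mul_div_assoc', div_mul_eq_mul_div]
  exact (eq_div_iff (SquareIce.sigmaProd_ne_zero hu hne)).2
    (theoremt_general n a ha_primitive u hu)
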